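/- Let $S$ be a finite regular semigroup (for every $a\in S$ there is $x\in S$ with $axa=a$), and let $a,b\in S$. Call $x,y\in S$ primarily conjugate if there are $u,v\in S^1$ with $x=uv$ and $y=vu$, where $S^1$ denotes $S$ with an identity element adjoined if necessary, and let $\sim$ be the transitive closure of this relation. Write $x\equiv y$ if for every finite-dimensional complex representation $\varphi:S\to\mathrm{End}_{\mathbb C}(V)$, that is, every multiplicative map from $S$ to the linear operators on a finite-dimensional complex vector space $V$, the traces of $\varphi(x)$ and $\varphi(y)$ are equal. Then $a\sim b$ if and only if $a\equiv b$. -/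

import Mathlib

universe u v

namespace SemigroupConj

/-- A semigroup is regular if every element `a` has some `x` with `a * x * a = a`. -/
def IsRegularSemigroup (S : Type u) [Semigroup S] : Prop :=
  ∀ a : S, ∃ x : S, a * x * a = a

/-- `x` and `y` are primarily conjugate: `x = uv` and `y = vu` for some `u, v ∈ S¹`.
`S¹` is taken as `WithOne S`. When `S` already has an identity, `u` and `v` may be taken in `S`
itself: if `u` or `v` is the adjoined identity, then `x = y`, and `x = x * e`, `y = e * x`
for the identity `e` of `S`. -/
def PrimarilyConj {S : Type u} [Semigroup S] (x y : S) : Prop :=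
  ∃ s t : WithOne S, (x : WithOne S) = s * t ∧ (y : WithOne S) = t * s

/-- The relation `x ∼ y`: the transitive closure of primary conjugacy. -/
def Conj {S : Type u} [Semigroup S] (x y : S) : Prop :=
  Relation.TransGen PrimarilyConj x y

/-- A complex representation of a semigroup `S` on `V`: a multiplicative map `S → End_ℂ(V)`
(no identity element is involved). -/
abbrev Rep (S : Type u) [Semigroup S] (V : Type v) [AddCommGroup V] [Module ℂ V] :=
  S →ₙ* Module.End ℂ V

/-- The character of a representation: the trace of the operator by which `s` acts. -/
noncomputable def Rep.character {S : Type u} [Semigroup S] {V : Type v} [AddCommGroup V]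
    [Module ℂ V] (φ : Rep S V) (s : S) : ℂ :=
  LinearMap.trace ℂ V (φ s)

/-- The relation `x ≡ y`: all finite-dimensional complex representations of `S` have equal
characters at `x` and `y`. -/
def CharacterConj {S : Type u} [Semigroup S] (x y : S) : Prop :=
  ∀ (V : Type v) [AddCommGroup V] [Module ℂ V] [FiniteDimensional ℂ V] (φ : Rep S V),
    Rep.character φ x = Rep.character φ y

end SemigroupConj

/-! Cyclicity of the trace gives one direction. For the converse, regularity moves each element
along `Conj` to a group element, some `g` with `g ^ (n + 1) = g` (`exists_conj_pow_succ_eq_self`).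
For group elements `g`, `h` with idempotents `e`, `f`, equal characters force `e` and `f` to
generate the same two-sided ideal (`mem_ideal_of_trace_eq`). Hence `h` can be transported into the
maximal subgroup at `e`, where it is conjugate to `g` (`exists_conj_of_trace_eq`). Both facts rest
on `sum_conj_eq_zero_of_trace`: the representations `eigenRep` separate the conjugacy classes of the
subgroup. Eigenspaces of convolution by a class function, a normal operator, play the role of
irreducible characters. -/

namespace SemigroupConj

open Module

/-! ### Idempotent powers and ideals in finite monoids. -/

section FiniteMonoid

variable {T : Type*} [Monoid T] [Finite T]

theorem exists_pos_isIdempotentElem_pow (a : T) : ∃ n : ℕ, 0 < n ∧ IsIdempotentElem (a ^ n) := by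
  obtain ⟨i, j, hne, hij⟩ := Finite.exists_ne_map_eq_of_infinite (fun n : ℕ => a ^ n)
  wlog hlt : i < j generalizing i j
  · exact this j i hne.symm hij.symm (by omega)
  obtain ⟨p, rfl⟩ := Nat.exists_eq_add_of_lt hlt
  have hij : a ^ i = a ^ (i + (p + 1)) := hij
  have hstep : ∀ n, i ≤ n → a ^ (n + (p + 1)) = a ^ n := by
    intro n hn
    obtain ⟨k, rfl⟩ := Nat.exists_eq_add_of_le hn
    rw [show i + k + (p + 1) = i + (p + 1) + k by ring, pow_add a (i + (p + 1)), ← hij, ← pow_add]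
  have hmul : ∀ k n, i ≤ n → a ^ (n + k * (p + 1)) = a ^ n := by
    intro k
    induction k with
    | zero => simp
    | succ k ih =>
      intro n hn
      rw [show n + (k + 1) * (p + 1) = n + k * (p + 1) + (p + 1) by ring,
        hstep _ (by omega), ih n hn]
  refine ⟨(i + 1) * (p + 1), by positivity, ?_⟩
  rw [IsIdempotentElem, ← pow_add]
  exact hmul _ _ (by nlinarith)

/-- Iterating gives `a = a ^ k * a * w ^ k`; an idempotent power `a ^ k` therefore fixes `a`. -/
theorem exists_pow_succ_eq_self_of_eq_mul {a w : T} (h : a = a * a * w) :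
    ∃ n : ℕ, 0 < n ∧ a ^ (n + 1) = a := by
  obtain ⟨n, hn, he⟩ := exists_pos_isIdempotentElem_pow a
  refine ⟨n, hn, ?_⟩
  have hk : ∀ k : ℕ, a = a ^ k * a * w ^ k := by
    intro k
    induction k with
    | zero => simp
    | succ k ih =>
      calc a = a ^ k * a * w ^ k := ih
        _ = a ^ k * (a * a * w) * w ^ k := by rw [← h]
        _ = a ^ (k + 1) * a * w ^ (k + 1) := by
          rw [pow_succ a, pow_succ' w]; simp only [mul_assoc]
  calc a ^ (n + 1) = a ^ n * a := pow_succ _ _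
    _ = a ^ n * (a ^ n * a * w ^ n) := by rw [← hk n]
    _ = a ^ n * a ^ n * a * w ^ n := by simp only [mul_assoc]
    _ = a := by rw [he.eq, ← hk n]

omit [Finite T] in
theorem isIdempotentElem_pow_of_pow_succ_eq_self {a : T} {n : ℕ} (hn : 0 < n)
    (h : a ^ (n + 1) = a) : IsIdempotentElem (a ^ n) := by
  obtain ⟨m, rfl⟩ := Nat.exists_eq_add_of_lt hn
  rw [IsIdempotentElem, ← pow_add, show 0 + m + 1 + (0 + m + 1) = 0 + m + 1 + 1 + m by ring,
    pow_add, h, ← pow_succ']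
  simp

/-- An idempotent below `f` that generates the same two-sided ideal is `f`. -/
theorem eq_of_idempotent_le_of_mul_mul_eq {f i r q : T} (hi : IsIdempotentElem i)
    (hfi : f * i = i) (hif : i * f = i) (h : f = r * i * q) : f = i := by
  have hk : ∀ k : ℕ, f = (r * i) ^ k * f * q ^ k := by
    intro k
    induction k with
    | zero => simp
    | succ k ih =>
      calc f = (r * i) ^ k * f * q ^ k := ih
        _ = (r * i) ^ k * (r * (i * f) * q) * q ^ k := by rw [hif, ← h]
        _ = (r * i) ^ (k + 1) * f * q ^ (k + 1) := by
          rw [pow_succ (r * i), pow_succ' q]; simp only [mul_assoc]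
  obtain ⟨n, hn, he⟩ := exists_pos_isIdempotentElem_pow (r * i)
  have h1 : (r * i) ^ n * f = f := by
    calc (r * i) ^ n * f = (r * i) ^ n * ((r * i) ^ n * f * q ^ n) := by rw [← hk n]
      _ = (r * i) ^ n * (r * i) ^ n * f * q ^ n := by simp only [mul_assoc]
      _ = f := by rw [he.eq, ← hk n]
  obtain ⟨m, rfl⟩ := Nat.exists_eq_add_of_lt hn
  have h2 : (r * i) ^ (0 + m + 1) * f = (r * i) ^ (0 + m + 1) * i := by
    rw [pow_succ]; simp only [mul_assoc, hif, hi.eq]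
  calc f = (r * i) ^ (0 + m + 1) * f * i := by rw [mul_assoc, hfi, ← h2, h1]
    _ = i := by rw [h1, hfi]

/-- Idempotents of a finite monoid that generate the same two-sided ideal are of the form
`u * v` and `v * u`. -/
theorem exists_mul_eq_and_mul_eq_of_idempotents {e f p q r s : T} (he : IsIdempotentElem e)
    (hf : IsIdempotentElem f) (hef : p * f * q = e) (hfe : r * e * s = f) :
    ∃ u v : T, u * v = e ∧ v * u = f ∧ e * u = u ∧ u * f = u ∧ v * e = v ∧ f * v = v := by
  set u := e * p * f with hu
  set v := f * q * e with hv
  have heu : e * u = u := by rw [hu]; simp only [← mul_assoc, he.eq]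
  have huf : u * f = u := by rw [hu, mul_assoc, hf.eq]
  have hve : v * e = v := by rw [hv, mul_assoc, he.eq]
  have hfv : f * v = v := by rw [hv]; simp only [← mul_assoc, hf.eq]
  have huv : u * v = e := by
    calc u * v = e * p * (f * f) * q * e := by rw [hu, hv]; simp only [mul_assoc]
      _ = e * (p * f * q) * e := by rw [hf.eq]; simp only [mul_assoc]
      _ = e := by rw [hef, he.eq, he.eq]
  refine ⟨u, v, huv, ?_, heu, huf, hve, hfv⟩
  have hi : IsIdempotentElem (v * u) := by
    rw [IsIdempotentElem, mul_assoc, ← mul_assoc u, huv, heu]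
  refine (eq_of_idempotent_le_of_mul_mul_eq (r := r * u) (q := v * s) hi ?_ ?_ ?_).symm
  · rw [← mul_assoc, hfv]
  · rw [mul_assoc, huf]
  · calc f = r * e * s := hfe.symm
      _ = r * (u * v * (u * v)) * s := by rw [huv, he.eq]
      _ = r * u * (v * u) * (v * s) := by simp only [mul_assoc]

end FiniteMonoid

/-! ### Eigenvectors of normal matrices and of convolution. -/

section NormalMatrix

-- The spectral radius of a normal matrix is its norm, so some eigenvalue has nonzero modulus.
open scoped Matrix.Norms.L2Operator in
theorem exists_ne_zero_mulVec_eq_smul_of_isStarNormal {n : Type*} [Fintype n] [DecidableEq n]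
    (A : Matrix n n ℂ) [IsStarNormal A] (hA : A ≠ 0) :
    ∃ c : ℂ, c ≠ 0 ∧ ∃ v : n → ℂ, v ≠ 0 ∧ A.mulVec v = c • v := by
  have : Nontrivial (Matrix n n ℂ) := ⟨A, 0, hA⟩
  obtain ⟨c, hc, hr⟩ := spectrum.exists_nnnorm_eq_spectralRadius A
  rw [IsStarNormal.spectralRadius_eq_nnnorm, ENNReal.coe_inj] at hr
  refine ⟨c, fun h => hA ?_, ?_⟩
  · rw [h, nnnorm_zero] at hr
    exact nnnorm_eq_zero.mp hr.symm
  · rw [← Matrix.spectrum_toLin', ← Module.End.hasEigenvalue_iff_mem_spectrum] at hc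
    obtain ⟨v, hv⟩ := hc.exists_hasEigenvector
    exact ⟨v, hv.2, by simpa using hv.apply_eq_smul⟩

/-- Convolution by a nonzero class function has an eigenvector with nonzero eigenvalue. -/
theorem exists_eigenvector_of_class_function {G : Type*} [Group G] [Fintype G] (z : G → ℂ)
    (hz : ∀ c k, z (c * k * c⁻¹) = z k) (h0 : z ≠ 0) :
    ∃ c : ℂ, c ≠ 0 ∧ ∃ F : G → ℂ, F ≠ 0 ∧ ∀ x, ∑ k, z k * F (k * x) = c * F x := by
  classical
  let A : Matrix G G ℂ := Matrix.of fun x y => z (y * x⁻¹)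
  have hA : A ≠ 0 := by
    intro h
    refine h0 (funext fun k => ?_)
    simpa [A] using congrFun (congrFun h 1) k
  have hcomm : ∀ x y, z (x * y) = z (y * x) := by
    intro x y
    rw [← hz x (y * x)]
    congr 1
    group
  have : IsStarNormal A := by
    refine ⟨?_⟩
    ext x y
    simp only [Matrix.mul_apply, Matrix.star_apply, A, Matrix.of_apply]
    -- The substitution `w ↦ x * w⁻¹ * y` swaps the two factors, as `z` is a class function.
    refine Fintype.sum_equiv ((Equiv.inv G).trans ((Equiv.mulLeft x).trans (Equiv.mulRight y)))
      _ _ fun w => ?_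
    simp only [Equiv.trans_apply, Equiv.inv_apply, Equiv.coe_mulLeft, Equiv.coe_mulRight]
    rw [mul_comm, mul_inv_cancel_right, mul_assoc x, hz, hcomm y]
  obtain ⟨c, hc, F, hF, h⟩ := exists_ne_zero_mulVec_eq_smul_of_isStarNormal A hA
  refine ⟨c, hc, F, hF, fun x => ?_⟩
  have hx := congrFun h x
  simp only [Matrix.mulVec, dotProduct, A, Matrix.of_apply, Pi.smul_apply, smul_eq_mul] at hx
  rw [← hx]
  exact Fintype.sum_equiv (Equiv.mulRight x) _ _ fun k => by simp

end NormalMatrix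

/-! ### Representations of a monoid induced from a maximal subgroup. -/

section Induced

theorem eq_zero_of_isIdempotentElem_of_trace_eq_zero {V : Type*} [AddCommGroup V] [Module ℂ V]
    [FiniteDimensional ℂ V] {p : Module.End ℂ V} (hp : IsIdempotentElem p)
    (h : LinearMap.trace ℂ V p = 0) : p = 0 :=
  LinearMap.IsIdempotentElem.eq_zero_of_trace_eq_zero hp h

variable {T : Type u} [Monoid T]

/-- The elements `x` for which `e * x` generates the same right ideal as `e`. -/
def RightGen (e : T) : Set T := {x | ∃ y, e * x * y = e}

/-- This makes `translate` multiplicative: a product that has left `RightGen e` never returns. -/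
theorem mem_rightGen_of_mul_mem {e x s : T} (h : x * s ∈ RightGen e) : x ∈ RightGen e := by
  obtain ⟨y, hy⟩ := h
  exact ⟨s * y, Eq.trans (by simp only [mul_assoc]) hy⟩

open Classical in
/-- The action of `T` on functions by right translation of the argument, cut off outside of
`RightGen e`. -/
noncomputable def translate (e : T) : T →ₙ* Module.End ℂ (T → ℂ) where
  toFun s :=
    { toFun := fun F x => if x * s ∈ RightGen e then F (x * s) else 0
      map_add' := fun F F' => by
        funext x
        by_cases h : x * s ∈ RightGen e <;> simp [h]
      map_smul' := fun c F => by
        funext x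
        by_cases h : x * s ∈ RightGen e <;> simp [h] }
  map_mul' s t := by
    refine LinearMap.ext fun F => funext fun x => ?_
    by_cases h : x * s * t ∈ RightGen e
    · simp [← mul_assoc, h, mem_rightGen_of_mul_mem h]
    · simp [← mul_assoc, h]

open Classical in
theorem translate_apply (e s : T) (F : T → ℂ) (x : T) :
    translate e s F x = if x * s ∈ RightGen e then F (x * s) else 0 := rfl

variable {G : Type*} [Group G] [Fintype G]

/-- The functions invariant under left multiplication of the argument by `e` on which left
convolution by `z` acts as the scalar `c`. -/
def convEigenspace (e : T) (ι : G →ₙ* T) (z : G → ℂ) (c : ℂ) : Submodule ℂ (T → ℂ) where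
  carrier := {F | (∀ x, F (e * x) = F x) ∧ ∀ x, ∑ k, z k * F (ι k * x) = c * F x}
  add_mem' := by
    rintro F F' ⟨h1, h2⟩ ⟨h1', h2'⟩
    refine ⟨fun x => by simp [h1, h1'], fun x => ?_⟩
    simp [mul_add, Finset.sum_add_distrib, h2, h2']
  zero_mem' := by simp
  smul_mem' := by
    rintro a F ⟨h1, h2⟩
    refine ⟨fun x => by simp [h1], fun x => ?_⟩
    simp only [Pi.smul_apply, smul_eq_mul, mul_left_comm _ a, ← Finset.mul_sum, h2]

variable {e : T} {ι : G →ₙ* T} (he : ι 1 = e)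
include he

omit [Fintype G] in
theorem mul_mem_rightGen_iff (k : G) (x : T) : ι k * x ∈ RightGen e ↔ x ∈ RightGen e := by
  have hk : ∀ k : G, e * ι k = ι k := fun k => by rw [← he, ← map_mul, one_mul]
  have hk' : ∀ k : G, ι k * e = ι k := fun k => by rw [← he, ← map_mul, mul_one]
  constructor
  · rintro ⟨y, hy⟩
    refine ⟨y * ι k, ?_⟩
    have h := congrArg (fun t => ι k⁻¹ * t * ι k) hy
    simp only [← mul_assoc, hk, hk', ← map_mul, inv_mul_cancel, he] at h
    simpa [mul_assoc] using h
  · rintro ⟨y, hy⟩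
    refine ⟨y * ι k⁻¹, ?_⟩
    calc e * (ι k * x) * (y * ι k⁻¹) = ι k * (e * x * y) * ι k⁻¹ := by
          simp only [← mul_assoc, hk, hk']
      _ = e := by rw [hy, hk', ← map_mul, mul_inv_cancel, he]

theorem translate_mem_convEigenspace {z : G → ℂ} {c : ℂ} (s : T) {F : T → ℂ}
    (hF : F ∈ convEigenspace e ι z c) : translate e s F ∈ convEigenspace e ι z c := by
  classical
  obtain ⟨h1, h2⟩ := hF
  refine ⟨fun x => ?_, fun x => ?_⟩
  · simp only [translate_apply, mul_assoc, h1]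
    simp only [← he, mul_mem_rightGen_iff rfl]
  · simp only [translate_apply, mul_assoc, mul_mem_rightGen_iff he]
    split_ifs with h
    · exact h2 _
    · simp

/-- `translate e` restricted to `convEigenspace e ι z c`. -/
noncomputable def eigenRep (z : G → ℂ) (c : ℂ) :
    T →ₙ* Module.End ℂ (convEigenspace e ι z c) where
  toFun s := (translate e s).restrict fun _ hF => translate_mem_convEigenspace he s hF
  map_mul' s t := by
    refine LinearMap.ext fun F => Subtype.ext ?_
    simp

theorem eigenRep_apply_coe (z : G → ℂ) (c : ℂ) (s : T) (F : convEigenspace e ι z c) :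
    (eigenRep he z c s F : T → ℂ) = translate e s F := rfl

/-- The purpose of the cut-off: these characters detect which ideals contain `e`. -/
theorem eigenRep_eq_zero (z : G → ℂ) (c : ℂ) {s : T} (hs : ∀ p q, p * s * q ≠ e) :
    eigenRep he z c s = 0 := by
  refine LinearMap.ext fun F => Subtype.ext (funext fun x => ?_)
  rw [eigenRep_apply_coe, translate_apply, if_neg]
  · rfl
  · rintro ⟨y, hy⟩
    exact hs (e * x) y (by simpa [mul_assoc] using hy)

variable (hι : ∀ m y, e * m = m → m * e = m → m * y = e → m ∈ Set.range ι)
include hι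

/-- Where the cut-off does not vanish, `e * x * e` lies in the subgroup. There right convolution by
the class function `z` equals left convolution, which is the scalar `c` on the eigenspace. -/
theorem sum_smul_eigenRep {z : G → ℂ} (hz : ∀ c k, z (c * k * c⁻¹) = z k) (c : ℂ) :
    ∑ k, z k • eigenRep he z c (ι k) = c • eigenRep he z c e := by
  have hee : e * e = e := by rw [← he, ← map_mul, one_mul]
  have hk : ∀ k : G, e * ι k = ι k := fun k => by rw [← he, ← map_mul, one_mul]
  refine LinearMap.ext fun F => Subtype.ext (funext fun x => ?_)
  obtain ⟨F, h1, h2⟩ := F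
  simp only [LinearMap.sum_apply, LinearMap.smul_apply, Submodule.coe_sum, Submodule.coe_smul,
    eigenRep_apply_coe, Finset.sum_apply, Pi.smul_apply, smul_eq_mul, translate_apply]
  by_cases hx : x * e ∈ RightGen e
  · obtain ⟨y, hy⟩ := hx
    obtain ⟨m, hm⟩ := hι (e * x * e) (e * y) (by simp only [← mul_assoc, hee])
      (by simp only [mul_assoc, hee]) (Eq.trans (by simp only [mul_assoc]; rw [← mul_assoc e e y, hee]) hy)
    have hxk : ∀ k, e * (x * ι k) = ι (m * k) := fun k => by
      rw [map_mul, hm]; simp only [mul_assoc, hk]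
    have hmem : ∀ k, x * ι k ∈ RightGen e := fun k =>
      ⟨ι (m * k)⁻¹, by rw [hxk, ← map_mul, mul_inv_cancel, he]⟩
    have hval : ∀ k, F (x * ι k) = F (ι (m * k)) := fun k => by rw [← h1, hxk]
    rw [if_pos ⟨y, hy⟩, ← h1 (x * e), ← mul_assoc, ← hm, ← h2]
    simp only [hmem, if_true, hval]
    refine Fintype.sum_equiv (MulAut.conj m).toEquiv _ _ fun k => ?_
    simp [← map_mul, hz]
  · rw [if_neg hx, mul_zero]
    refine Finset.sum_eq_zero fun k _ => ?_
    rw [if_neg, mul_zero]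
    rw [← hk k, ← mul_assoc]
    exact fun h => hx (mem_rightGen_of_mul_mem h)

omit hι in
theorem eigenRep_ne_zero (hinj : Function.Injective ι) {z : G → ℂ} {c : ℂ} {F : G → ℂ}
    (hF : F ≠ 0) (hFz : ∀ x, ∑ k, z k * F (k * x) = c * F x) : eigenRep he z c e ≠ 0 := by
  classical
  have hee : e * e = e := by rw [← he, ← map_mul, one_mul]
  have hk : ∀ k : G, e * ι k = ι k := fun k => by rw [← he, ← map_mul, one_mul]
  have hk' : ∀ k : G, ι k * e = ι k := fun k => by rw [← he, ← map_mul, mul_one]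
  obtain ⟨g, hg⟩ := Function.ne_iff.mp hF
  -- Extension by zero off the subgroup, precomposed with `e * ·` to make it left invariant under
  -- `e`.
  let F' : T → ℂ := fun x => Function.extend ι F 0 (e * x)
  have hF' : ∀ k, F' (ι k) = F k := fun k => by
    simp only [F', hk, hinj.extend_apply]
  have hmem : F' ∈ convEigenspace e ι z c := by
    refine ⟨fun x => by simp only [F', ← mul_assoc, hee], fun x => ?_⟩
    by_cases hx : e * x ∈ Set.range ι
    · obtain ⟨m, hm⟩ := hx
      have h : ∀ k, e * (ι k * x) = ι (k * m) := fun k => by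
        rw [map_mul, hm, ← mul_assoc, ← mul_assoc, hk, hk']
      simp only [F', h, ← hm, hinj.extend_apply, hFz]
    · have h : ∀ k, e * (ι k * x) ∉ Set.range ι := by
        rintro k ⟨m, hm⟩
        refine hx ⟨k⁻¹ * m, ?_⟩
        rw [map_mul, hm, ← mul_assoc, ← mul_assoc, hk', ← map_mul, inv_mul_cancel, he]
      have hzero : ∀ t, t ∉ Set.range ι → Function.extend ι F 0 t = 0 := fun t ht => by
        rw [Function.extend_apply' _ _ _ (by simpa using ht)]; rfl
      simp only [F', hzero _ hx, hzero _ (h _), mul_zero, Finset.sum_const_zero]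
  intro h
  have h' := congrFun (congrArg Subtype.val (LinearMap.congr_fun h ⟨F', hmem⟩)) (ι g)
  rw [eigenRep_apply_coe, translate_apply, hk', if_pos ⟨ι g⁻¹, by
    rw [hk, ← map_mul, mul_inv_cancel, he]⟩] at h'
  exact hg ((hF' g).symm.trans h')

/-- A function on the maximal subgroup at `e` that is orthogonal to all characters of `T` has
zero sum over each conjugacy class. -/
theorem sum_conj_eq_zero_of_trace [Finite T] (hinj : Function.Injective ι) (w : G → ℂ)
    (hw : ∀ z c, ∑ k, w k * LinearMap.trace ℂ _ (eigenRep he z c (ι k)) = 0) (k : G) :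
    ∑ c, w (c⁻¹ * k * c) = 0 := by
  by_contra hk0
  let z : G → ℂ := fun k => ∑ c, w (c⁻¹ * k * c)
  have hz : ∀ c k, z (c * k * c⁻¹) = z k := fun c k =>
    Fintype.sum_equiv (Equiv.mulLeft c⁻¹) _ _ fun d => by simp [mul_assoc]
  obtain ⟨c, hc, F, hF, hFz⟩ := exists_eigenvector_of_class_function z hz
    (fun h => hk0 (congrFun h k))
  have hconj : ∀ d k, LinearMap.trace ℂ _ (eigenRep he z c (ι (d * k * d⁻¹))) =
      LinearMap.trace ℂ _ (eigenRep he z c (ι k)) := fun d k => by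
    rw [map_mul, map_mul (eigenRep he z c), LinearMap.trace_mul_comm, ← map_mul, ← map_mul,
      inv_mul_cancel_left]
  -- The left side has trace zero by the hypothesis on `w`, so the idempotent by which `e` acts has
  -- trace zero and vanishes.
  have htr := congrArg (LinearMap.trace ℂ _) (sum_smul_eigenRep he hι hz c)
  have h0 : ∑ k, z k * LinearMap.trace ℂ _ (eigenRep he z c (ι k)) = 0 := by
    have hzk : ∀ k, z k = ∑ c, w (c⁻¹ * k * c) := fun _ => rfl
    simp only [hzk, Finset.sum_mul]
    rw [Finset.sum_comm]
    refine Finset.sum_eq_zero fun d _ => ?_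
    rw [← hw z c]
    refine Fintype.sum_equiv (MulAut.conj d⁻¹).toEquiv _ _ fun k => ?_
    have h1 := hconj d⁻¹ k
    have h2 : (MulAut.conj d⁻¹).toEquiv k = d⁻¹ * k * d := by simp
    rw [inv_inv] at h1
    rw [h2, h1]
  rw [map_sum] at htr
  simp only [map_smul, smul_eq_mul, h0] at htr
  have hidem : IsIdempotentElem (eigenRep he z c e) := by
    have hee : e * e = e := by rw [← he, ← map_mul, one_mul]
    rw [IsIdempotentElem, ← map_mul, hee]
  rcases mul_eq_zero.mp htr.symm with h | h
  · exact hc h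
  · exact eigenRep_ne_zero he hinj hF hFz 
      (eq_zero_of_isIdempotentElem_of_trace_eq_zero hidem h)

end Induced

/-! ### The maximal subgroup as the unit group of `eTe`. -/

section Corner

variable {T : Type u} [Monoid T] {e : T}

/-- The monoid `eTe` with identity `e`. -/
abbrev cornerMonoid (he : IsIdempotentElem e) : Monoid (Subsemigroup.corner e) where
  one := ⟨e, e, by simp only [he.eq]⟩
  one_mul x := Subtype.ext ((Subsemigroup.mem_corner_iff he).mp x.2).1
  mul_one x := Subtype.ext ((Subsemigroup.mem_corner_iff he).mp x.2).2

/-- The maximal subgroup of a finite monoid at an idempotent. -/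
theorem exists_maximal_subgroup [Finite T] (he : IsIdempotentElem e) :
    ∃ (G : Type u) (_ : Group G) (_ : Fintype G) (ι : G →ₙ* T), ι 1 = e ∧
      Function.Injective ι ∧
      ∀ m y, e * m = m → m * e = m → m * y = e → m ∈ Set.range ι := by
  let _ := cornerMonoid he
  have : Finite (Subsemigroup.corner e)ˣ := Finite.of_injective _ Units.val_injective
  refine ⟨(Subsemigroup.corner e)ˣ, inferInstance, Fintype.ofFinite _,
    ⟨fun k => (k.1 : T), fun _ _ => rfl⟩, rfl, fun k l h => Units.ext (Subtype.ext h), ?_⟩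
  intro m y h1 h2 hy
  let m' : Subsemigroup.corner e := ⟨m, (Subsemigroup.mem_corner_iff he).mpr ⟨h1, h2⟩⟩
  let y' : Subsemigroup.corner e := ⟨e * y * e, y, rfl⟩
  have h : m' * y' = 1 := Subtype.ext (by
    change m * (e * y * e) = e
    rw [← mul_assoc, ← mul_assoc, h2, hy, he.eq])
  exact ⟨⟨m', y', h, mul_eq_one_symm h⟩, rfl⟩

end Corner

/-! ### Group elements with equal characters. -/

section Main

variable {T : Type u} [Monoid T] [Finite T]

theorem mem_ideal_of_trace_eq {g h e : T} {n : ℕ} (hn : 0 < n) (hg : g ^ (n + 1) = g)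
    (he : g ^ n = e)
    (H : ∀ (V : Type u) [AddCommGroup V] [Module ℂ V] [FiniteDimensional ℂ V]
      (φ : T →ₙ* Module.End ℂ V), LinearMap.trace ℂ V (φ g) = LinearMap.trace ℂ V (φ h)) :
    ∃ p q, p * h * q = e := by
  classical
  by_contra! hno
  have hid : IsIdempotentElem e := he ▸ isIdempotentElem_pow_of_pow_succ_eq_self hn hg
  obtain ⟨G, _, _, ι, hι1, hinj, hι⟩ := exists_maximal_subgroup hid
  obtain ⟨k, rfl⟩ := hι g (g ^ (n - 1)) (by rw [← he, ← pow_succ, hg])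
    (by rw [← he, ← pow_succ', hg]) (by rw [← pow_succ', Nat.sub_add_cancel hn, he])
  have hsum := sum_conj_eq_zero_of_trace hι1 hι hinj (Pi.single k 1) (fun z c => by
    rw [Finset.sum_eq_single k (fun l _ hl => by simp [hl]) (by simp), H,
      eigenRep_eq_zero hι1 z c hno, map_zero, mul_zero])
  -- Summed over all `l`, the class sums of the point mass at `k` give the order of `G`, which is
  -- not zero.
  have h2 : ∑ l, ∑ c, (Pi.single k 1 : G → ℂ) (c⁻¹ * l * c) = 0 :=
    Finset.sum_eq_zero fun l _ => hsum l
  rw [Finset.sum_comm] at h2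
  have h3 : ∀ c, ∑ l, (Pi.single k 1 : G → ℂ) (c⁻¹ * l * c) = 1 := fun c => by
    rw [← Finset.sum_pi_single' k (1 : ℂ) Finset.univ |>.trans (if_pos (Finset.mem_univ k))]
    exact Fintype.sum_equiv ((MulAut.conj c⁻¹).toEquiv) _ _ fun l => by
      simp [Pi.single_apply]
  simp [h3] at h2

theorem exists_conj_of_trace_eq {G : Type*} [Group G] [Fintype G] {e : T} {ι : G →ₙ* T}
    (he : ι 1 = e) (hinj : Function.Injective ι)
    (hι : ∀ m y, e * m = m → m * e = m → m * y = e → m ∈ Set.range ι) {k l : G}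
    (H : ∀ (V : Type u) [AddCommGroup V] [Module ℂ V] [FiniteDimensional ℂ V]
      (φ : T →ₙ* Module.End ℂ V),
      LinearMap.trace ℂ V (φ (ι k)) = LinearMap.trace ℂ V (φ (ι l))) :
    ∃ c, c⁻¹ * k * c = l := by
  classical
  by_contra! hno
  have hsum := sum_conj_eq_zero_of_trace he hι hinj (Pi.single k 1 - Pi.single l 1)
    (fun z c => by
      simp only [Pi.sub_apply, sub_mul, Finset.sum_sub_distrib]
      rw [Finset.sum_eq_single k (fun l _ hl => by simp [hl]) (by simp),
        Finset.sum_eq_single l (fun l _ hl => by simp [hl]) (by simp), H]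
      simp) k
  have h1 : ∀ c : G, (Pi.single l 1 : G → ℂ) (c⁻¹ * k * c) = 0 := fun c =>
    Pi.single_eq_of_ne (hno c) _
  -- The remaining sum is the order of the centralizer of `k`.
  simp only [Pi.sub_apply, h1, sub_zero, Pi.single_apply, Finset.sum_boole] at hsum
  have h2 : (1 : G) ∈ Finset.univ.filter fun c : G => c⁻¹ * k * c = k := by simp
  exact Finset.card_ne_zero_of_mem h2 (by exact_mod_cast hsum)

theorem exists_mul_of_trace_eq {g h : T} {n m : ℕ} (hn : 0 < n) (hm : 0 < m)
    (hg : g ^ (n + 1) = g) (hh : h ^ (m + 1) = h)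
    (H : ∀ (V : Type u) [AddCommGroup V] [Module ℂ V] [FiniteDimensional ℂ V]
      (φ : T →ₙ* Module.End ℂ V), LinearMap.trace ℂ V (φ g) = LinearMap.trace ℂ V (φ h)) :
    ∃ s t, g = s * t ∧ h = t * s := by
  obtain ⟨e, he⟩ : ∃ e, g ^ n = e := ⟨_, rfl⟩
  obtain ⟨f, hf⟩ : ∃ f, h ^ m = f := ⟨_, rfl⟩
  have hid : IsIdempotentElem e := he ▸ isIdempotentElem_pow_of_pow_succ_eq_self hn hg
  have hidf : IsIdempotentElem f := hf ▸ isIdempotentElem_pow_of_pow_succ_eq_self hm hh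
  have hfh : f * h = h := by rw [← hf, ← pow_succ, hh]
  have heg : e * g = g := by rw [← he, ← pow_succ, hg]
  have hge : g * e = g := by rw [← he, ← pow_succ', hg]
  obtain ⟨p, q, hpq⟩ := mem_ideal_of_trace_eq hn hg he H
  obtain ⟨r, s, hrs⟩ := mem_ideal_of_trace_eq hm hh hf fun V _ _ _ φ => (H V φ).symm
  obtain ⟨u, v, huv, hvu, heu, huf, hve, hfv⟩ := exists_mul_eq_and_mul_eq_of_idempotents
    (p := p) (q := h * q) (r := r) (s := g * s) hid hidf
    (by rw [← hpq, ← hfh]; simp only [mul_assoc, ← mul_assoc f f, hidf.eq])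
    (by rw [← hrs, ← heg]; simp only [mul_assoc, ← mul_assoc e e, hid.eq])
  obtain ⟨G, _, _, ι, hι1, hinj, hι⟩ := exists_maximal_subgroup hid
  obtain ⟨k, hk⟩ := hι g (g ^ (n - 1)) heg hge (by rw [← pow_succ', Nat.sub_add_cancel hn, he])
  -- Since `u * v = e` and `v * u = f`, the map `t ↦ u * t * v` carries the subgroup at `f` to that
  -- at `e`; it preserves traces by cyclicity.
  obtain ⟨l, hl⟩ := hι (u * h * v) (u * h ^ (m - 1) * v)
    (by simp only [← mul_assoc, heu]) (by simp only [mul_assoc, hve]) (by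
      calc u * h * v * (u * h ^ (m - 1) * v) = u * (h * (v * u) * h ^ (m - 1)) * v := by
            simp only [mul_assoc]
        _ = u * (h * h ^ m) * h ^ (m - 1) * v := by rw [hvu, ← hf]; simp only [mul_assoc]
        _ = u * h ^ m * v := by
            rw [← pow_succ', hh, mul_assoc u, ← pow_succ', Nat.sub_add_cancel hm]
        _ = e := by rw [hf, huf, huv])
  obtain ⟨c, hc⟩ := exists_conj_of_trace_eq hι1 hinj hι (k := k) (l := l)
    (fun V _ _ _ φ => by
      rw [hk, hl, H, map_mul φ, map_mul φ, LinearMap.trace_mul_comm, ← map_mul, ← map_mul,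
        ← mul_assoc, hvu, hfh])
  have hkc : k = c * l * c⁻¹ := by rw [← hc]; group
  have hcc : ι c⁻¹ * ι c = e := by rw [← map_mul, inv_mul_cancel, hι1]
  refine ⟨ι c * (u * h), v * ι c⁻¹, ?_, ?_⟩
  · rw [← hk, hkc, map_mul, map_mul, hl]
    simp only [mul_assoc]
  · calc h = f * f * h := by rw [hidf.eq, hfh]
      _ = v * (u * v) * u * h := by rw [← hvu]; simp only [mul_assoc]
      _ = v * (ι c⁻¹ * ι c) * u * h := by rw [huv, hcc]
      _ = v * ι c⁻¹ * (ι c * (u * h)) := by simp only [mul_assoc]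

end Main

/-! ### Reduction from regular semigroups to group elements. -/

section Semigroup

variable {S : Type u} [Semigroup S]

theorem trace_eq_of_primarilyConj {V : Type*} [AddCommGroup V] [Module ℂ V] (φ : Rep S V)
    {x y : S} (h : PrimarilyConj x y) : φ.character x = φ.character y := by
  obtain ⟨s, t, hx, hy⟩ := h
  have hφ : ∀ x : S, φ x = WithOne.lift φ x := fun x => (WithOne.lift_coe φ x).symm
  rw [Rep.character, Rep.character, hφ, hφ, hx, hy, map_mul (WithOne.lift φ),
    map_mul (WithOne.lift φ), LinearMap.trace_mul_comm]

theorem PrimarilyConj.of_mul (u v : S) : PrimarilyConj (u * v) (v * u) :=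
  ⟨u, v, by simp, by simp⟩

theorem Conj.symm {x y : S} (h : Conj x y) : Conj y x := by
  have : Std.Symm (PrimarilyConj (S := S)) := ⟨fun _ _ ⟨s, t, h1, h2⟩ => ⟨t, s, h2, h1⟩⟩
  exact Relation.TransGen.stdSymm.symm _ _ h

theorem CharacterConj.of_conj {x y : S} (h : Conj x y) : CharacterConj.{u, v} x y := by
  intro V _ _ _ φ
  induction h with
  | single h => exact trace_eq_of_primarilyConj φ h
  | tail _ h ih => exact ih.trans (trace_eq_of_primarilyConj φ h)

/-- Frees the universe: every finite-dimensional representation has an isomorphic copy on a lift of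
`ℂⁿ`. -/
theorem CharacterConj.trace_eq {x y : S} (h : CharacterConj.{u, v} x y) {W : Type*}
    [AddCommGroup W] [Module ℂ W] [FiniteDimensional ℂ W] (φ : Rep S W) :
    φ.character x = φ.character y := by
  let E : W ≃ₗ[ℂ] ULift.{v} (Fin (finrank ℂ W) → ℂ) :=
    (finBasis ℂ W).equivFun.trans ULift.moduleEquiv.symm
  let ψ : Rep S (ULift.{v} (Fin (finrank ℂ W) → ℂ)) :=
    ⟨fun s => E.conj (φ s), fun s t => by
      rw [map_mul]; exact LinearEquiv.conj_comp E _ _⟩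
  have hψ : ∀ s, ψ.character s = φ.character s := fun s => LinearMap.trace_conj' (φ s) E
  rw [← hψ, ← hψ]
  exact h _ ψ

/-- With `a = a * x * a`, the conjugate `a * (a * x)` has a right ideal inside `a * S`. Either it is
smaller and induction applies, or `a` lies in `a * a * S` and is a group element. -/
theorem exists_conj_pow_succ_eq_self [Finite S] (hS : IsRegularSemigroup S) (a : S) :
    ∃ g : S, Conj a g ∧ ∃ n : ℕ, 0 < n ∧ (g : WithOne S) ^ (n + 1) = g := by
  have hfin : Finite (WithOne S) := inferInstanceAs (Finite (Option S))
  induction hN : (Set.range (a * ·)).ncard using Nat.strong_induction_on generalizing a with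
  | _ N ih =>
  obtain ⟨x, hx⟩ := hS a
  have hax : Conj a (a * (a * x)) := by
    have h := PrimarilyConj.of_mul (a * x) a
    rw [hx] at h
    exact .single h
  have hsub : Set.range (a * (a * x) * ·) ⊆ Set.range (a * ·) := by
    rintro _ ⟨t, rfl⟩
    exact ⟨a * x * t, by simp only [mul_assoc]⟩
  by_cases heq : Set.range (a * (a * x) * ·) = Set.range (a * ·)
  · have ha : a ∈ Set.range (a * (a * x) * ·) := by
      rw [heq]
      exact ⟨x * a, by simpa only [mul_assoc] using hx⟩
    obtain ⟨t, ht⟩ := ha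
    have hw : (a : WithOne S) = a * a * ((x * t : S) : WithOne S) := by
      rw [← WithOne.coe_mul, ← WithOne.coe_mul, WithOne.coe_inj]
      simpa only [mul_assoc] using ht.symm
    -- `TransGen` has no built-in reflexivity, so `Conj a a` comes from going there and back.
    exact ⟨a, hax.trans hax.symm, exists_pow_succ_eq_self_of_eq_mul hw⟩
  · obtain ⟨g, hg, hn⟩ := ih _ (hN ▸ Set.ncard_lt_ncard (hsub.ssubset_of_ne heq)
      (Set.toFinite _)) (a * (a * x)) rfl
    exact ⟨g, hax.trans hg, hn⟩

theorem Conj.of_characterConj [Finite S] (hS : IsRegularSemigroup S) {a b : S}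
    (hab : CharacterConj.{u, v} a b) : Conj a b := by
  have hfin : Finite (WithOne S) := inferInstanceAs (Finite (Option S))
  obtain ⟨g, hag, n, hn, hg⟩ := exists_conj_pow_succ_eq_self hS a
  obtain ⟨h, hbh, m, hm, hh⟩ := exists_conj_pow_succ_eq_self hS b
  have hgh : PrimarilyConj g h := exists_mul_of_trace_eq hn hm hg hh fun V _ _ _ φ => by
    have ha := CharacterConj.of_conj.{u, u} hag
    have hb := CharacterConj.of_conj.{u, u} hbh
    have hφ := (ha.trace_eq (φ.comp WithOne.coeMulHom)).symm.trans
      ((hab.trace_eq (φ.comp WithOne.coeMulHom)).trans (hb.trace_eq (φ.comp WithOne.coeMulHom)))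
    exact hφ
  exact (hag.tail hgh).trans hbh.symm

end Semigroup

end SemigroupConj

theorem mainTheorem3 {S : Type u} [Semigroup S] [Finite S]
    (hS : SemigroupConj.IsRegularSemigroup S) (a b : S) :
    SemigroupConj.Conj a b ↔ SemigroupConj.CharacterConj.{u, v} a b :=
  ⟨SemigroupConj.CharacterConj.of_conj, SemigroupConj.Conj.of_characterConj hS⟩
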